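/- Let $n,d\ge 0$ be integers, let $R=\mathbb{C}[[x_1,\dots,x_n]]$, let $K=\operatorname{Frac}(R)$ with the partial derivations $\partial/\partial x_i$ extended from $R$ to $K$, let $L=\{x^\beta : \beta\in\mathbb{N}^n\}$ be the set of monomials and let $R_L=L^{-1}R\subseteq K$. For a commutative ring $B$, $GL_d(B)$ is the group of $d\times d$ matrices over $B$ whose determinant is invertible in $B$. A *Pfaffian system with normal crossings* $[A]$ is a system $$x_i^{p_i+1}\frac{\partial F}{\partial x_i}=A_iF,\qquad 1\le i\le n,$$ with $p_i\in\mathbb{Z}$ and $A_i\in R^{d\times d}$. It is *completely integrable* if for all $i,j$ $$A_iA_j-A_jA_i=x_i^{p_i+1}\frac{\partial A_j}{\partial x_i}-x_j^{p_j+1}\frac{\partial A_i}{\partial x_j}.$$ A matrix $T\in GL_d(K)$ is *weakly compatible* with $[A]$ if the system obtained from $[A]$ by the gauge transformation $F=TG$ is again a completely integrable Pfaffian system with normal crossings, that is, if there is a completely integrable system $[\tilde A]$ as above, with $\tilde p_i\in\mathbb{Z}$ and $\tilde A_i\in R^{d\times d}$, such that $$\frac{\tilde A_i}{x_i^{\tilde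 p_i+1}}=T^{-1}\left(\frac{A_i}{x_i^{p_i+1}}T-\frac{\partial T}{\partial x_i}\right),\qquad 1\le i\le n.$$ **Proposition.** Let $[A]$ be a completely integrable Pfaffian system with normal crossings and let $T\in GL_d(K)$ be weakly compatible with $[A]$. Then $T\in GL_d(R_L)$, i.e. all entries of $T$ lie in $R_L$ and $\det T$ is invertible in $R_L$. In particular, each of $\det T$ and $(\det T)^{-1}$ lies in $R_L$, i.e. is a power series divided by a monomial. -/

import Mathlib

noncomputable section

namespace Pfaffian

/-- The ring `ℂ⟦x₁, …, xₙ⟧` of formal power series. -/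
abbrev R (n : ℕ) : Type := MvPowerSeries (Fin n) ℂ

/-- The fraction field of `ℂ⟦x₁, …, xₙ⟧`. -/
abbrev K (n : ℕ) : Type := FractionRing (R n)

/-- The variable `xᵢ`, as an element of the fraction field. -/
def x {n : ℕ} (i : Fin n) : K n := algebraMap (R n) (K n) (MvPowerSeries.X i)

/-- The value of the quotient rule for `∂/∂xᵢ` at the fraction `a / b`. -/
def quotRule {n : ℕ} (i : Fin n) (a b : R n) : K n :=
  algebraMap (R n) (K n)
      (MvPowerSeries.pderiv ℂ i a * b - a * MvPowerSeries.pderiv ℂ i b) /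
    algebraMap (R n) (K n) b ^ 2

/-- The formal partial derivative `∂/∂xᵢ` on the fraction field, as a function: write the element
as a fraction and use the quotient rule. -/
def pderivFun {n : ℕ} (i : Fin n) (f : K n) : K n :=
  quotRule i (IsLocalization.sec (nonZeroDivisors (R n)) f).1
    (IsLocalization.sec (nonZeroDivisors (R n)) f).2

/-- The derivative does not depend on the fraction chosen. -/
theorem pderivFun_div {n : ℕ} (i : Fin n) (a b : R n) (hb : b ≠ 0) :
    pderivFun i (algebraMap (R n) (K n) a / algebraMap (R n) (K n) b) = quotRule i a b := by
  have inj := IsFractionRing.injective (R n) (K n)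
  have hbK : algebraMap (R n) (K n) b ≠ 0 := by
    simpa using (map_ne_zero_iff _ inj).2 hb
  set f : K n := algebraMap (R n) (K n) a / algebraMap (R n) (K n) b with hf
  unfold pderivFun
  set s := IsLocalization.sec (nonZeroDivisors (R n)) f with hs
  have h1 : f * algebraMap (R n) (K n) s.2 = algebraMap (R n) (K n) s.1 :=
    IsLocalization.sec_spec (nonZeroDivisors (R n)) f
  have hd0 : (s.2 : R n) ≠ 0 := nonZeroDivisors.coe_ne_zero s.2
  generalize (s.2 : R n) = d at h1 hd0
  generalize s.1 = c at h1
  have hdK : algebraMap (R n) (K n) d ≠ 0 := (map_ne_zero_iff _ inj).2 hd0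
  have h2 : a * d = c * b := by
    apply inj
    rw [map_mul, map_mul, ← h1, hf]
    field_simp
  have h3 := congrArg (MvPowerSeries.pderiv ℂ i) h2
  simp only [Derivation.leibniz, smul_eq_mul] at h3
  have h4 : (MvPowerSeries.pderiv ℂ i c * d - c * MvPowerSeries.pderiv ℂ i d) * b ^ 2
      = (MvPowerSeries.pderiv ℂ i a * b - a * MvPowerSeries.pderiv ℂ i b) * d ^ 2 := by
    linear_combination (-(b * d)) * h3 +
      (b * MvPowerSeries.pderiv ℂ i d + d * MvPowerSeries.pderiv ℂ i b) * h2
  unfold quotRule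
  rw [div_eq_div_iff (pow_ne_zero 2 hdK) (pow_ne_zero 2 hbK)]
  have h5 := congrArg (algebraMap (R n) (K n)) h4
  simpa only [map_mul, map_pow] using h5

theorem pderivFun_algebraMap {n : ℕ} (i : Fin n) (a : R n) :
    pderivFun i (algebraMap (R n) (K n) a) =
      algebraMap (R n) (K n) (MvPowerSeries.pderiv ℂ i a) := by
  have h := pderivFun_div i a 1 one_ne_zero
  simpa [quotRule] using h

theorem pderivFun_add {n : ℕ} (i : Fin n) (f g : K n) :
    pderivFun i (f + g) = pderivFun i f + pderivFun i g := by
  have inj := IsFractionRing.injective (R n) (K n)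
  obtain ⟨a, b, hb, rfl⟩ := IsFractionRing.div_surjective (R n) f
  obtain ⟨c, d, hd, rfl⟩ := IsFractionRing.div_surjective (R n) g
  have hb0 := nonZeroDivisors.ne_zero hb
  have hd0 := nonZeroDivisors.ne_zero hd
  have hbK : algebraMap (R n) (K n) b ≠ 0 := (map_ne_zero_iff _ inj).2 hb0
  have hdK : algebraMap (R n) (K n) d ≠ 0 := (map_ne_zero_iff _ inj).2 hd0
  rw [div_add_div _ _ hbK hdK, ← map_mul, ← map_mul, ← map_mul, ← map_add,
    pderivFun_div i _ _ (mul_ne_zero hb0 hd0), pderivFun_div i _ _ hb0, pderivFun_div i _ _ hd0]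
  simp only [quotRule, Derivation.leibniz, map_add, map_sub, map_mul, smul_eq_mul]
  field_simp
  ring

theorem pderivFun_mul {n : ℕ} (i : Fin n) (f g : K n) :
    pderivFun i (f * g) = f * pderivFun i g + g * pderivFun i f := by
  have inj := IsFractionRing.injective (R n) (K n)
  obtain ⟨a, b, hb, rfl⟩ := IsFractionRing.div_surjective (R n) f
  obtain ⟨c, d, hd, rfl⟩ := IsFractionRing.div_surjective (R n) g
  have hb0 := nonZeroDivisors.ne_zero hb
  have hd0 := nonZeroDivisors.ne_zero hd
  have hbK : algebraMap (R n) (K n) b ≠ 0 := (map_ne_zero_iff _ inj).2 hb0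
  have hdK : algebraMap (R n) (K n) d ≠ 0 := (map_ne_zero_iff _ inj).2 hd0
  rw [div_mul_div_comm, ← map_mul, ← map_mul,
    pderivFun_div i _ _ (mul_ne_zero hb0 hd0), pderivFun_div i _ _ hb0, pderivFun_div i _ _ hd0]
  simp only [quotRule, Derivation.leibniz, map_add, map_sub, map_mul, smul_eq_mul]
  field_simp
  ring

theorem pderivFun_smul {n : ℕ} (i : Fin n) (r : ℂ) (f : K n) :
    pderivFun i (r • f) = r • pderivFun i f := by
  rw [← algebraMap_smul (R n) r f, ← algebraMap_smul (R n) r (pderivFun i f), Algebra.smul_def,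
    Algebra.smul_def, pderivFun_mul, pderivFun_algebraMap, Derivation.map_algebraMap]
  simp

/-- The formal partial derivative `∂/∂xᵢ` on the fraction field of `ℂ⟦x₁, …, xₙ⟧`. -/
def pderiv {n : ℕ} (i : Fin n) : Derivation ℂ (K n) (K n) :=
  Derivation.mk'
    { toFun := pderivFun i
      map_add' := pderivFun_add i
      map_smul' := pderivFun_smul i } (pderivFun_mul i)

theorem pderiv_algebraMap {n : ℕ} (i : Fin n) (a : R n) :
    pderiv i (algebraMap (R n) (K n) a) =
      algebraMap (R n) (K n) (MvPowerSeries.pderiv ℂ i a) :=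
  pderivFun_algebraMap i a

/-- The multiplicative set `L` of all monomials `x₁^β₁ ⋯ xₙ^βₙ`, `β ∈ ℕⁿ`. -/
def L (n : ℕ) : Submonoid (R n) where
  carrier := {f | ∃ β : Fin n →₀ ℕ, f = MvPowerSeries.monomial β (1 : ℂ)}
  one_mem' := ⟨0, by simp⟩
  mul_mem' := by
    rintro _ _ ⟨β, rfl⟩ ⟨γ, rfl⟩
    exact ⟨β + γ, by rw [MvPowerSeries.monomial_mul_monomial, one_mul]⟩

theorem L_le (n : ℕ) : L n ≤ nonZeroDivisors (R n) := by
  rintro _ ⟨β, rfl⟩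
  rw [mem_nonZeroDivisors_iff_ne_zero]
  intro h
  have h1 := congrArg (MvPowerSeries.coeff β) h
  simp at h1

/-- The localization `R_L = L⁻¹ R`, as a subalgebra of the fraction field: the elements
`a * s⁻¹` with `a` a power series and `s` a monomial. -/
def RL (n : ℕ) : Subalgebra (R n) (K n) := Localization.subalgebra.ofField (K n) (L n) (L_le n)

/-- The data of a linear system `xᵢ ^ (pᵢ + 1) ∂F/∂xᵢ = Aᵢ F`, `1 ≤ i ≤ n`, of size `d`, where the
`pᵢ` are integers and the `Aᵢ` are matrices of formal power series
(a Pfaffian system with normal crossings). -/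
structure System (n d : ℕ) where
  p : Fin n → ℤ
  A : Fin n → Matrix (Fin d) (Fin d) (R n)

namespace System

variable {n d : ℕ}

/-- `Aᵢ` with its entries regarded in the fraction field. -/
def AK (S : System n d) (i : Fin n) : Matrix (Fin d) (Fin d) (K n) :=
  (S.A i).map (algebraMap (R n) (K n))

/-- Complete integrability:
`Aᵢ Aⱼ - Aⱼ Aᵢ = xᵢ ^ (pᵢ + 1) ∂Aⱼ/∂xᵢ - xⱼ ^ (pⱼ + 1) ∂Aᵢ/∂xⱼ` for all `i`, `j`. -/
def IsCompletelyIntegrable (S : System n d) : Prop :=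
  ∀ i j : Fin n, S.AK i * S.AK j - S.AK j * S.AK i =
    x i ^ (S.p i + 1) • (S.AK j).map (pderiv i) - x j ^ (S.p j + 1) • (S.AK i).map (pderiv j)

/-- The matrix `Aᵢ / xᵢ ^ (pᵢ + 1)`. -/
def conn (S : System n d) (i : Fin n) : Matrix (Fin d) (Fin d) (K n) :=
  (x i ^ (S.p i + 1))⁻¹ • S.AK i

/-- The gauge transformation `F = T G` turns the system `S` into the system `S'`:
`A'ᵢ / xᵢ ^ (p'ᵢ + 1) = T⁻¹ (Aᵢ / xᵢ ^ (pᵢ + 1) T - ∂T/∂xᵢ)` for all `i`. -/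
def IsTransformedTo (T : GL (Fin d) (K n)) (S S' : System n d) : Prop :=
  ∀ i : Fin n, S'.conn i =
    (T⁻¹).val * (S.conn i * T.val - T.val.map (pderiv i))

/-- `T` is weakly compatible with `S`: the transformed system is again a completely integrable
Pfaffian system with normal crossings. -/
def IsWeaklyCompatible (T : GL (Fin d) (K n)) (S : System n d) : Prop :=
  ∃ S' : System n d, S'.IsCompletelyIntegrable ∧ IsTransformedTo T S S'

end System

end Pfaffian

end

namespace Pfaffian

variable {n : ℕ}

/-! Solving the gauge equation for the derivative gives `∂T/∂xᵢ = Pᵢ T - T Qᵢ`, where `Pᵢ` and `Qᵢ`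
have entries in `R_L`. Hence the `R_L`-span of the entries of `T` contains their partial
derivatives. The power series `f` that multiply every entry into `R_L` form an ideal, nonzero
because finitely many fractions have a common denominator, and stable under all `∂/∂xᵢ` by the
product rule. In characteristic zero such an ideal contains a unit (`one_mem_of_pderiv_stable`), so
the entries themselves lie in `R_L` (`mem_RL_of_pderiv_mem_span`). Exchanging the two systems gives
the same for `T⁻¹`. -/

theorem mem_RL_iff {f : K n} :
    f ∈ RL n ↔ ∃ a s : R n, s ∈ L n ∧
      f = algebraMap (R n) (K n) a * (algebraMap (R n) (K n) s)⁻¹ := by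
  change (∃ (a s : R n) (_ : s ∈ L n), f = _) ↔ _
  simp only [exists_prop]

theorem algebraMap_mem_RL (a : R n) : algebraMap (R n) (K n) a ∈ RL n :=
  (RL n).algebraMap_mem a

theorem inv_monomial_mem_RL {s : R n} (hs : s ∈ L n) : (algebraMap (R n) (K n) s)⁻¹ ∈ RL n :=
  mem_RL_iff.2 ⟨1, s, hs, by simp⟩

theorem pderiv_mem_RL (i : Fin n) {f : K n} (hf : f ∈ RL n) : pderiv i f ∈ RL n := by
  obtain ⟨a, s, hs, rfl⟩ := mem_RL_iff.1 hf
  rw [Derivation.leibniz, Derivation.leibniz_inv, pderiv_algebraMap, pderiv_algebraMap]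
  have hi := inv_monomial_mem_RL hs
  exact add_mem
    (mul_mem (algebraMap_mem_RL a) (mul_mem (neg_mem (pow_mem hi 2)) (algebraMap_mem_RL _)))
    (mul_mem hi (algebraMap_mem_RL _))

theorem inv_x_zpow_mem_RL (i : Fin n) (m : ℤ) : (x i ^ m)⁻¹ ∈ RL n := by
  have hx : x i ∈ RL n := algebraMap_mem_RL _
  have hx' : (x i)⁻¹ ∈ RL n := inv_monomial_mem_RL ⟨Finsupp.single i 1, rfl⟩
  cases m with
  | ofNat k => simpa using pow_mem hx' k
  | negSucc k => simpa using pow_mem hx (k + 1)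

/-- A nonzero ideal of power series stable under all partial derivatives is the unit ideal. -/
theorem one_mem_of_pderiv_stable {I : Ideal (R n)}
    (hI : ∀ i, ∀ f ∈ I, MvPowerSeries.pderiv ℂ i f ∈ I)
    (h0 : I ≠ ⊥) : (1 : R n) ∈ I := by
  obtain ⟨f, hf, hf0⟩ := Submodule.exists_mem_ne_zero_of_ne_bot h0
  obtain ⟨β, hβ⟩ : ∃ β, MvPowerSeries.coeff β f ≠ 0 := by
    by_contra! h
    exact hf0 (MvPowerSeries.ext h)
  clear hf0
  -- Induct on the degree of a monomial occurring in `f`. Differentiating by a variable dividing it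
  -- lowers the degree by one and multiplies its coefficient by a positive integer; at degree zero
  -- the constant term is nonzero, so `f` is a unit.
  induction hk : β.degree generalizing f β with
  | zero =>
    obtain rfl := (Finsupp.degree_eq_zero_iff β).1 hk
    refine (Ideal.eq_top_iff_one I).1 (Ideal.eq_top_of_isUnit_mem I hf ?_)
    rw [MvPowerSeries.isUnit_iff_constantCoeff]
    simpa using hβ
  | succ k ih =>
    obtain ⟨i, hi⟩ : ∃ i, β i ≠ 0 := by
      by_contra! h
      obtain rfl : β = 0 := Finsupp.ext h
      simp at hk
    have hle : Finsupp.single i 1 ≤ β := by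
      simpa [Finsupp.single_le_iff] using Nat.one_le_iff_ne_zero.2 hi
    obtain ⟨γ, rfl⟩ := exists_add_of_le hle
    refine ih _ (hI i f hf) γ ?_ ?_
    · rw [MvPowerSeries.coeff_pderiv, add_comm γ]
      exact mul_ne_zero hβ (Nat.cast_add_one_ne_zero (γ i))
    · simp at hk
      omega

/-- A finite family in the fraction field whose `R_L`-span contains all first partial derivatives
of its members consists of elements of `R_L`. -/
theorem mem_RL_of_pderiv_mem_span {ι : Type*} [Finite ι] (t : ι → K n)
    (ht : ∀ i k, pderiv i (t k) ∈ Submodule.span (RL n) (Set.range t)) (k : ι) : t k ∈ RL n := by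
  -- The ideal of common denominators of the family, relative to `R_L`.
  let I : Ideal (R n) :=
    { carrier := {f | ∀ k, algebraMap (R n) (K n) f * t k ∈ RL n}
      zero_mem' := fun k => by simp
      add_mem' := fun hf hg k => by
        rw [map_add, add_mul]
        exact add_mem (hf k) (hg k)
      smul_mem' := fun c f hf k => by
        rw [smul_eq_mul, map_mul, mul_assoc]
        exact mul_mem (algebraMap_mem_RL c) (hf k) }
  have hspan : ∀ f ∈ I, ∀ v ∈ Submodule.span (RL n) (Set.range t),
      algebraMap (R n) (K n) f * v ∈ RL n := by
    intro f hf v hv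
    induction hv using Submodule.span_induction with
    | mem v hv =>
      obtain ⟨k, rfl⟩ := hv
      exact hf k
    | zero => simp
    | add v w _ _ hv hw =>
      rw [mul_add]
      exact add_mem hv hw
    | smul c v _ hv =>
      rw [mul_smul_comm]
      exact mul_mem c.2 hv
  have hI : ∀ i, ∀ f ∈ I, MvPowerSeries.pderiv ℂ i f ∈ I := by
    intro i f hf k
    -- Product rule: `(∂f) t = ∂(f t) - f ∂t`, with both terms on the right in `R_L`.
    have h := sub_mem (pderiv_mem_RL i (hf k)) (hspan f hf _ (ht i k))
    rw [Derivation.leibniz, pderiv_algebraMap, smul_eq_mul, smul_eq_mul, add_sub_cancel_left,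
      mul_comm] at h
    exact h
  have h0 : I ≠ ⊥ := by
    obtain ⟨b, hb⟩ := IsLocalization.exist_integer_multiples_of_finite (nonZeroDivisors (R n)) t
    refine (Submodule.ne_bot_iff I).2 ⟨b, fun k => ?_, nonZeroDivisors.coe_ne_zero b⟩
    obtain ⟨a, ha⟩ := hb k
    rw [← Algebra.smul_def]
    exact ha ▸ algebraMap_mem_RL a
  simpa using one_mem_of_pderiv_stable hI h0 k

theorem entry_mem_RL_of_map_pderiv {m : Type*} [Fintype m] (T : Matrix m m (K n))
    (P Q : Fin n → Matrix m m (K n)) (hP : ∀ i a b, P i a b ∈ RL n) (hQ : ∀ i a b, Q i a b ∈ RL n)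
    (hT : ∀ i, T.map (pderiv i) = P i * T - T * Q i) (a b : m) : T a b ∈ RL n := by
  refine mem_RL_of_pderiv_mem_span (fun k : m × m => T k.1 k.2) (fun i k => ?_) (a, b)
  have hmem (c e : m) :
      T c e ∈ Submodule.span (RL n) (Set.range fun k : m × m => T k.1 k.2) :=
    Submodule.subset_span ⟨(c, e), rfl⟩
  have h : pderiv i (T k.1 k.2) = (P i * T - T * Q i) k.1 k.2 := by
    rw [← hT i, Matrix.map_apply]
  rw [h, Matrix.sub_apply, Matrix.mul_apply, Matrix.mul_apply]
  refine sub_mem (sum_mem fun j _ => ?_) (sum_mem fun j _ => ?_)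
  · exact Submodule.smul_mem _ (⟨P i k.1 j, hP i k.1 j⟩ : RL n) (hmem j k.2)
  · rw [mul_comm]
    exact Submodule.smul_mem _ (⟨Q i j k.2, hQ i j k.2⟩ : RL n) (hmem k.1 j)

theorem map_pderiv_mul {m : Type*} [Fintype m] (i : Fin n) (M N : Matrix m m (K n)) :
    (M * N).map (pderiv i) = M * N.map (pderiv i) + M.map (pderiv i) * N := by
  ext a b
  simp only [Matrix.map_apply, Matrix.mul_apply, Matrix.add_apply, map_sum, Derivation.leibniz,
    smul_eq_mul, Finset.sum_add_distrib]
  congr 1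
  exact Finset.sum_congr rfl fun _ _ => mul_comm _ _

theorem map_pderiv_one {m : Type*} [DecidableEq m] (i : Fin n) :
    (1 : Matrix m m (K n)).map (pderiv i) = 0 := by
  ext a b
  by_cases h : a = b <;> simp [h]

theorem System.conn_mem_RL {d : ℕ} (S : System n d) (i : Fin n) (a b : Fin d) :
    S.conn i a b ∈ RL n :=
  mul_mem (inv_x_zpow_mem_RL i _) (algebraMap_mem_RL _)

namespace System.IsTransformedTo

variable {d : ℕ} {T : GL (Fin d) (K n)} {S S' : System n d}

theorem map_pderiv (h : IsTransformedTo T S S') (i : Fin n) :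
    T.val.map (pderiv i) = S.conn i * T.val - T.val * S'.conn i := by
  rw [h i, ← mul_assoc, Units.mul_inv, one_mul, sub_sub_cancel]

/-- Follows by differentiating `T T⁻¹ = 1`. -/
theorem inv (h : IsTransformedTo T S S') : IsTransformedTo T⁻¹ S' S := by
  intro i
  have h1 := map_pderiv_mul i T.val (T⁻¹).val
  rw [Units.mul_inv, map_pderiv_one, h.map_pderiv i, sub_mul, mul_assoc, Units.mul_inv,
    mul_one] at h1
  rw [inv_inv, mul_sub, ← mul_assoc]
  linear_combination (norm := abel) -h1

theorem entry_mem_RL (h : IsTransformedTo T S S') (a b : Fin d) : T.val a b ∈ RL n :=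
  entry_mem_RL_of_map_pderiv T.val S.conn S'.conn S.conn_mem_RL S'.conn_mem_RL h.map_pderiv a b

end System.IsTransformedTo

theorem exists_map_eq_of_entry_mem {A B : Type*} [CommRing A] [CommRing B] [Algebra A B]
    (C : Subalgebra A B) {d : ℕ} (T : GL (Fin d) B) (h : ∀ a b, T.val a b ∈ C)
    (h' : ∀ a b, (T⁻¹).val a b ∈ C) :
    ∃ U : GL (Fin d) C, Matrix.GeneralLinearGroup.map C.val.toRingHom U = T := by
  have inj : Function.Injective fun M : Matrix (Fin d) (Fin d) C => M.map C.val.toRingHom :=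
    Matrix.map_injective Subtype.val_injective
  let V : Matrix (Fin d) (Fin d) C := Matrix.of fun a b => ⟨T.val a b, h a b⟩
  let W : Matrix (Fin d) (Fin d) C := Matrix.of fun a b => ⟨(T⁻¹).val a b, h' a b⟩
  have hV : V.map C.val.toRingHom = T.val := rfl
  have hW : W.map C.val.toRingHom = (T⁻¹).val := rfl
  -- The two inverse relations descend to `C` because its inclusion into `B` is injective.
  refine ⟨⟨V, W, inj ?_, inj ?_⟩, Units.ext hV⟩
  · simp only [Matrix.map_mul, hV, hW, Units.mul_inv, Matrix.map_one _ (map_zero _) (map_one _)]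
  · simp only [Matrix.map_mul, hV, hW, Units.inv_mul, Matrix.map_one _ (map_zero _) (map_one _)]

theorem det_mem_of_entry_mem {A B : Type*} [CommRing A] [CommRing B] [Algebra A B]
    (C : Subalgebra A B) {d : ℕ} (M : Matrix (Fin d) (Fin d) B) (h : ∀ a b, M a b ∈ C) :
    M.det ∈ C := by
  rw [Matrix.det_apply]
  exact sum_mem fun σ _ => zsmul_mem (prod_mem fun a _ => h _ _) _

end Pfaffian

theorem proposition2p3 (n d : ℕ) (S : Pfaffian.System n d) (hS : S.IsCompletelyIntegrable)
    (T : GL (Fin d) (Pfaffian.K n)) (hT : Pfaffian.System.IsWeaklyCompatible T S) :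
    (∃ U : GL (Fin d) (Pfaffian.RL n),
      Matrix.GeneralLinearGroup.map (Pfaffian.RL n).val.toRingHom U = T) ∧
    T.val.det ∈ Pfaffian.RL n ∧ (T.val.det)⁻¹ ∈ Pfaffian.RL n := by
  obtain ⟨S', -, h⟩ := hT
  refine ⟨Pfaffian.exists_map_eq_of_entry_mem _ T h.entry_mem_RL h.inv.entry_mem_RL,
    Pfaffian.det_mem_of_entry_mem _ _ h.entry_mem_RL, ?_⟩
  have hdet : (T⁻¹).val.det = (T.val.det)⁻¹ := by
    refine eq_inv_of_mul_eq_one_left ?_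
    rw [← Matrix.det_mul, Units.inv_mul, Matrix.det_one]
  exact hdet ▸ Pfaffian.det_mem_of_entry_mem _ _ h.inv.entry_mem_RL
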